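/- Call a function $f:(0,\infty)\to\mathbb{R}$ operator monotone if, for every unital $C^*$-algebra $\mathcal{A}$ and all self-adjoint $A\le B$ in $\mathcal{A}$ with $\mathrm{sp}(A)\cup\mathrm{sp}(B)\subseteq(0,\infty)$ for which $f(A)$ and $f(B)$ are defined by the continuous functional calculus (i.e. $f$ is continuous on $\mathrm{sp}(A)$ and on $\mathrm{sp}(B)$, which is automatic for Hermitian matrices), one has $f(A)\le f(B)$. Theorem. Let $f:(0,\infty)\to(0,\infty)$ be operator monotone. Then $f$ is differentiable on $(0,\infty)$. Moreover, for every $t_1>0$ the function $-L_{t_1}f$ is operator monotone on $(0,\infty)$, where $L_{t_1}f(t)=\dfrac{f(t)-f(t_1)}{t-t_1}$ for $t\neq t_1$ and $L_{t_1}f(t_1)=f'(t_1)$. -/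

import Mathlib

universe u

/-- `f` is operator monotone on `I ⊆ ℝ`: for every (unital, complex) C⋆-algebra `𝒜` and all
self-adjoint `A ≤ B` in `𝒜` with spectra contained in `I`, one has `f(A) ≤ f(B)`.

Here `f(A)` is the continuous functional calculus; the two continuity requirements only say that
`f(A)` and `f(B)` are defined. They hold automatically when the spectra are finite (for instance
for all Hermitian matrices), and for all `A`, `B` when `f` is continuous on `I`. -/
def IsOperatorMonotoneOn (f : ℝ → ℝ) (I : Set ℝ) : Prop :=
  ∀ (𝒜 : Type u) [CStarAlgebra 𝒜] [PartialOrder 𝒜] [StarOrderedRing 𝒜] (A B : 𝒜),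
    IsSelfAdjoint A → IsSelfAdjoint B → spectrum ℝ A ⊆ I → spectrum ℝ B ⊆ I →
    ContinuousOn f (spectrum ℝ A) → ContinuousOn f (spectrum ℝ B) →
    A ≤ B → cfc f A ≤ cfc f B

/-- The divided-difference transform `L_{t₁} f`: it sends `t` to `(f t - f t₁) / (t - t₁)` for
`t ≠ t₁`, and `t₁` to `f'(t₁)`. -/
noncomputable def dividedDifference (t₁ : ℝ) (f : ℝ → ℝ) : ℝ → ℝ :=
  fun t => if t = t₁ then deriv f t₁ else (f t - f t₁) / (t - t₁)

/-- The transform agrees with Mathlib's `dslope`. -/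
theorem dividedDifference_eq_dslope (t₁ : ℝ) (f : ℝ → ℝ) :
    dividedDifference t₁ f = dslope f t₁ := by
  funext t
  by_cases h : t = t₁
  · subst h
    simp [dividedDifference]
  · simp [dividedDifference, h, dslope_of_ne f h, slope_def_field]

/-! A positive operator monotone `f` on the half-line is a pointwise limit of nonnegative
combinations of the functions `k_x(t) = t / (t + x)`, `x > 0`. The divided difference of `k_x` at
`t₁` is `x / ((t₁ + x) * (t + x))`, which is operator decreasing because inversion is antitone. For
combinations of the `k_x`, the divided differences obey a Lipschitz bound governed by the value at
`t₁` alone, hence are equicontinuous along the approximation. So they converge uniformly on spectra,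
which preserves the operator order, and the limit is continuous, which makes `f` differentiable at
`t₁`.

The approximation (`exists_mem_rationalCone`) is a duality argument. By Hahn-Banach it suffices that
a finite functional `c` which is nonnegative on every `k_x` is nonnegative on `f`. Clearing
denominators in `∑ c t * k_x(t)` gives a polynomial `N(x)`, nonnegative for `x > 0`, so `N = σ₀ + X
* σ₁` with sums of squares. The values `N(-t)` recover `c t`, and for an even number of nodes `∑ c t
* f t` is minus the divided difference of `N(-t) * f t / t`. Two inequalities for divided
differences then suffice: that of `P ^ 2 * f` is nonnegative (`sum_nodalWeight_nonneg`), and that of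
`P ^ 2 * f / t` is nonpositive (`sum_nodalWeight_div_nonpos`).

The first is operator monotonicity tested on two matrices whose eigenvalues are alternate nodes and
whose difference has rank one. The second follows by adding two nodes and sending one to infinity
and the other to zero. The hypothesis on `f` is thus used for matrices only. -/

open Matrix Polynomial Filter Topology
open scoped NNReal

/-! ### Functional calculus of conjugated diagonal matrices -/

/-- Conjugating real diagonal matrices by a matrix `U` with orthonormal columns, as a homomorphism
of real algebras. -/
noncomputable def conjDiagonal {ι : Type u} [Fintype ι] [DecidableEq ι] (U : Matrix ι ι ℂ)
    (hU : Uᴴ * U = 1) : (ι → ℝ) →ₐ[ℝ] Matrix ι ι ℂ where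
  toFun d := Uᴴ * diagonal (fun i => (d i : ℂ)) * U
  map_one' := by simp [hU]
  map_mul' d e := by
    have hU' : U * Uᴴ = 1 := mul_eq_one_comm.mp hU
    calc Uᴴ * diagonal (fun i => (((d * e) i : ℝ) : ℂ)) * U
        = Uᴴ * (diagonal (fun i => (d i : ℂ)) * diagonal (fun i => (e i : ℂ))) * U := by
          simp [diagonal_mul_diagonal]
      _ = Uᴴ * (diagonal (fun i => (d i : ℂ)) * (U * Uᴴ) * diagonal (fun i => (e i : ℂ))) * U := by
          rw [hU', mul_one]
      _ = _ := by simp only [mul_assoc]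
  map_zero' := by simp
  map_add' d e := by
    simp only [Pi.add_apply, Complex.ofReal_add]
    rw [← diagonal_add, mul_add, add_mul]
  commutes' r := by
    have : diagonal (fun i : ι => ((algebraMap ℝ (ι → ℝ) r i : ℝ) : ℂ)) = (r : ℂ) • 1 := by
      ext i j
      by_cases h : i = j <;> simp [h, one_apply]
    rw [this, mul_smul_comm, smul_mul_assoc, mul_one, hU, Algebra.algebraMap_eq_smul_one]
    ext i j
    simp

theorem conjDiagonal_apply {ι : Type u} [Fintype ι] [DecidableEq ι] (U : Matrix ι ι ℂ)
    (hU : Uᴴ * U = 1) (d : ι → ℝ) :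
    conjDiagonal U hU d = Uᴴ * diagonal (fun i => (d i : ℂ)) * U := rfl

theorem spectrum_conjDiagonal_subset {ι : Type u} [Fintype ι] [DecidableEq ι] (U : Matrix ι ι ℂ)
    (hU : Uᴴ * U = 1) (d : ι → ℝ) : spectrum ℝ (conjDiagonal U hU d) ⊆ Set.range d := by
  refine (AlgHom.spectrum_apply_subset _ d).trans ?_
  intro r hr
  rw [Pi.spectrum_eq] at hr
  obtain ⟨i, hi⟩ := Set.mem_iUnion.mp hr
  have : d i = r := by
    by_contra h
    rw [spectrum.mem_iff, isUnit_iff_ne_zero, not_not] at hi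
    exact h (sub_eq_zero.mp hi).symm
  exact ⟨i, this⟩

theorem isSelfAdjoint_conjDiagonal {ι : Type u} [Fintype ι] [DecidableEq ι] (U : Matrix ι ι ℂ)
    (hU : Uᴴ * U = 1) (d : ι → ℝ) : IsSelfAdjoint (conjDiagonal U hU d) := by
  rw [isSelfAdjoint_iff, conjDiagonal_apply, star_eq_conjTranspose]
  simp [conjTranspose_mul, mul_assoc, diagonal_conjTranspose, Pi.star_def]

open scoped MatrixOrder ComplexOrder Matrix.Norms.L2Operator in
-- On the finite spectrum `f` agrees with an interpolating polynomial, and polynomials commute with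
-- algebra homomorphisms.
theorem cfc_conjDiagonal {ι : Type u} [Fintype ι] [DecidableEq ι] (U : Matrix ι ι ℂ)
    (hU : Uᴴ * U = 1) (f : ℝ → ℝ) (d : ι → ℝ) :
    cfc f (conjDiagonal U hU d) = conjDiagonal U hU (f ∘ d) := by
  set p : ℝ[X] := Lagrange.interpolate (Finset.univ.image d) id f with hp
  have hpd : ∀ i, p.eval (d i) = f (d i) := fun i =>
    Lagrange.eval_interpolate_at_node (v := id) f Function.injective_id.injOn
      (Finset.mem_image_of_mem d (Finset.mem_univ i))
  have h1 : cfc f (conjDiagonal U hU d) = cfc p.eval (conjDiagonal U hU d) := by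
    refine cfc_congr fun r hr => ?_
    obtain ⟨i, rfl⟩ := spectrum_conjDiagonal_subset U hU d hr
    exact (hpd i).symm
  rw [h1, cfc_polynomial p _ (isSelfAdjoint_conjDiagonal U hU d), aeval_algHom_apply]
  congr 1
  ext i
  have h2 := aeval_algHom_apply (Pi.evalAlgHom ℝ (fun _ : ι => ℝ) i) d p
  simp only [Pi.evalAlgHom_apply, coe_aeval_eq_eval] at h2
  rw [← h2, hpd, Function.comp_apply]

open scoped MatrixOrder ComplexOrder Matrix.Norms.L2Operator in
/-- Operator monotonicity for a pair of real symmetric matrices `diag a ≤ Oᵀ (diag b) O`, whose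
difference has rank one. -/
theorem IsOperatorMonotoneOn.sum_le_sum {f : ℝ → ℝ} {I : Set ℝ} (hf : IsOperatorMonotoneOn.{u} f I)
    {ι : Type u} [Fintype ι] [DecidableEq ι] {a b v : ι → ℝ} {O : Matrix ι ι ℝ}
    (ha : ∀ i, a i ∈ I) (hb : ∀ i, b i ∈ I) (hO : Oᵀ * O = 1)
    (hv : Oᵀ * diagonal b * O - diagonal a = vecMulVec v v) (x : ι → ℝ) :
    ∑ i, f (a i) * x i ^ 2 ≤ ∑ i, f (b i) * (O *ᵥ x) i ^ 2 := by
  set U : Matrix ι ι ℂ := O.map Complex.ofRealHom with hUdef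
  have hUH : Uᴴ = Oᵀ.map Complex.ofRealHom := by
    ext i j; simp [U]
  have hdiag : ∀ d : ι → ℝ, diagonal (fun i => (d i : ℂ)) = (diagonal d).map Complex.ofRealHom := by
    intro d
    rw [diagonal_map (map_zero _)]
    rfl
  have hU : Uᴴ * U = 1 := by
    rw [hUH, hUdef, ← Matrix.map_mul, hO, Matrix.map_one _ (map_zero _) (map_one _)]
  have h1 : (1 : Matrix ι ι ℂ)ᴴ * 1 = 1 := by simp
  have hB : ∀ d : ι → ℝ, conjDiagonal U hU d = (Oᵀ * diagonal d * O).map Complex.ofRealHom := by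
    intro d
    rw [conjDiagonal_apply, hUH, hUdef, hdiag, ← Matrix.map_mul, ← Matrix.map_mul]
  have hA : ∀ d : ι → ℝ, conjDiagonal 1 h1 d = (diagonal d).map Complex.ofRealHom := by
    intro d
    rw [conjDiagonal_apply, hdiag]; simp
  have hle : conjDiagonal 1 h1 a ≤ conjDiagonal U hU b := by
    rw [Matrix.le_iff, hB, hA, ← Matrix.map_sub (f := Complex.ofRealHom) (fun _ _ => map_sub _ _ _), hv]
    have : (vecMulVec v v).map Complex.ofRealHom
        = vecMulVec (fun i => (v i : ℂ)) (star fun i => (v i : ℂ)) := by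
      ext i j; simp [vecMulVec_apply]
    rw [this]
    exact posSemidef_vecMulVec_self_star _
  have hsA : spectrum ℝ (conjDiagonal 1 h1 a) ⊆ Set.range a := spectrum_conjDiagonal_subset _ _ _
  have hsB : spectrum ℝ (conjDiagonal U hU b) ⊆ Set.range b := spectrum_conjDiagonal_subset _ _ _
  -- The spectra are finite, so the continuity requirements hold for an arbitrary `f`.
  have key := hf (Matrix ι ι ℂ) _ _ (isSelfAdjoint_conjDiagonal 1 h1 a)
    (isSelfAdjoint_conjDiagonal U hU b) (hsA.trans (Set.range_subset_iff.mpr ha))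
    (hsB.trans (Set.range_subset_iff.mpr hb))
    (((Set.finite_range a).subset hsA).continuousOn f)
    (((Set.finite_range b).subset hsB).continuousOn f) hle
  rw [cfc_conjDiagonal, cfc_conjDiagonal, Matrix.le_iff, hB, hA,
    ← Matrix.map_sub (f := Complex.ofRealHom) (fun _ _ => map_sub _ _ _)] at key
  have h2 := key.dotProduct_mulVec_nonneg (fun i => (x i : ℂ))
  have h3 : star (fun i => (x i : ℂ)) ⬝ᵥ
      ((Oᵀ * diagonal (f ∘ b) * O - diagonal (f ∘ a)).map Complex.ofRealHom *ᵥ fun i => (x i : ℂ))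
      = ((x ⬝ᵥ ((Oᵀ * diagonal (f ∘ b) * O - diagonal (f ∘ a)) *ᵥ x) : ℝ) : ℂ) := by
    simp [dotProduct, mulVec]
  rw [h3] at h2
  have h4 : 0 ≤ x ⬝ᵥ ((Oᵀ * diagonal (f ∘ b) * O - diagonal (f ∘ a)) *ᵥ x) := by
    exact_mod_cast h2
  rw [sub_mulVec, dotProduct_sub, ← mulVec_mulVec, ← mulVec_mulVec, dotProduct_mulVec,
    vecMul_transpose] at h4
  have h5 : ∀ (d y : ι → ℝ), y ⬝ᵥ (diagonal d *ᵥ y) = ∑ i, d i * y i ^ 2 := by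
    intro d y
    simp only [dotProduct, mulVec_diagonal]
    exact Finset.sum_congr rfl fun i _ => by ring
  rw [h5, h5] at h4
  simpa using h4

/-! ### Divided differences and Loewner's inequality -/

/-- The divided difference over `S` vanishes on polynomials of degree less than `#S - 1`, and picks
out the coefficient of degree `#S - 1` from polynomials of that degree. -/
theorem sum_nodalWeight_mul_eval (S : Finset ℝ) {Q : ℝ[X]} (hQ : Q.degree < S.card) :
    ∑ t ∈ S, Lagrange.nodalWeight S id t * Q.eval t = Q.coeff (S.card - 1) := by
  rw [Lagrange.coeff_eq_sum (v := id) Function.injective_id.injOn hQ]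
  refine Finset.sum_congr rfl fun t _ => ?_
  simp [Lagrange.nodalWeight, div_eq_mul_inv, Finset.prod_inv_distrib, mul_comm]

theorem nodalWeight_orderEmbOfFin (S : Finset ℝ) {n : ℕ} (hS : S.card = n) (i : Fin n) :
    Lagrange.nodalWeight S id (S.orderEmbOfFin hS i) =
      Lagrange.nodalWeight Finset.univ (S.orderEmbOfFin hS) i := by
  set e := S.orderEmbOfFin hS with he
  have hSe : S = Finset.univ.map e.toEmbedding := (S.map_orderEmbOfFin_univ hS).symm
  unfold Lagrange.nodalWeight
  have : S.erase (e i) = (Finset.univ.erase i).map e.toEmbedding := by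
    rw [Finset.map_erase, ← hSe]; rfl
  rw [this, Finset.prod_map]
  rfl

/-- The negative factors of the weight are those from the `n - 1 - i` nodes to the right of `e i`.
-/
theorem nodalWeight_univ_sign {n : ℕ} {e : Fin n → ℝ} (he : StrictMono e) (i : Fin n) :
    0 < (-1) ^ (n - 1 - (i : ℕ)) * Lagrange.nodalWeight Finset.univ e i := by
  have hsplit : Finset.univ.erase i = Finset.Ioi i ∪ Finset.Iio i := by
    ext j
    simp [lt_or_lt_iff_ne, ne_comm]
  have hdisj : Disjoint (Finset.Ioi i) (Finset.Iio i) := by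
    rw [Finset.disjoint_left]
    intro j hj hj'
    exact lt_asymm (Finset.mem_Ioi.mp hj) (Finset.mem_Iio.mp hj')
  rw [Lagrange.nodalWeight, hsplit, Finset.prod_union hdisj, ← mul_assoc,
    show n - 1 - (i : ℕ) = (Finset.Ioi i).card by rw [Fin.card_Ioi], ← Finset.prod_const,
    ← Finset.prod_mul_distrib]
  refine mul_pos (Finset.prod_pos fun j hj => ?_) (Finset.prod_pos fun j hj => ?_)
  · have := he (Finset.mem_Ioi.mp hj)
    rw [neg_one_mul, neg_pos]
    exact inv_lt_zero.mpr (sub_neg.mpr this)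
  · have := he (Finset.mem_Iio.mp hj)
    exact inv_pos.mpr (sub_pos.mpr this)

/-- Loewner's inequality for two families of nodes on which the weights of the divided difference
have opposite signs. -/
theorem IsOperatorMonotoneOn.sum_nodalWeight_nonneg_of_sign {f : ℝ → ℝ} {I : Set ℝ}
    (hf : IsOperatorMonotoneOn.{u} f I) {ι : Type u} [Fintype ι] [DecidableEq ι] {a b : ι → ℝ}
    (ha : ∀ i, a i ∈ I) (hb : ∀ i, b i ∈ I) (hinj : Function.Injective a) (S : Finset ℝ)
    (hsum : ∀ g : ℝ → ℝ, ∑ t ∈ S, g t = ∑ i, g (a i) + ∑ i, g (b i))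
    (hwa : ∀ i, Lagrange.nodalWeight S id (a i) < 0)
    (hwb : ∀ i, 0 < Lagrange.nodalWeight S id (b i))
    {P : ℝ[X]} (hP : P.degree < Fintype.card ι) :
    0 ≤ ∑ t ∈ S, Lagrange.nodalWeight S id t * (P.eval t ^ 2 * f t) := by
  set w := Lagrange.nodalWeight S id with hw
  have hcard : S.card = 2 * Fintype.card ι := by
    have := hsum fun _ => 1
    simp only [Finset.sum_const, Finset.card_univ, nsmul_eq_mul, mul_one] at this
    have h : (S.card : ℝ) = (2 * Fintype.card ι : ℕ) := by rw [this]; push_cast; ring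
    exact_mod_cast h
  set α : ι → ℝ := fun i => √(-w (a i)) with hα
  set β : ι → ℝ := fun i => √(w (b i)) with hβ
  have hα0 : ∀ i, α i ≠ 0 := fun i => (Real.sqrt_pos.mpr (neg_pos.mpr (hwa i))).ne'
  have hα2 : ∀ i, α i * α i = -w (a i) := fun i => Real.mul_self_sqrt (neg_pos.mpr (hwa i)).le
  have hβ2 : ∀ i, β i * β i = w (b i) := fun i => Real.mul_self_sqrt (hwb i).le
  set l : ι → ℝ[X] := fun i => Lagrange.basis Finset.univ a i with hl
  have hla : ∀ i k, (l i).eval (a k) = if i = k then 1 else 0 := by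
    intro i k
    split_ifs with h
    · subst h
      exact Lagrange.eval_basis_self hinj.injOn (Finset.mem_univ _)
    · exact Lagrange.eval_basis_of_ne h (Finset.mem_univ _)
  have hldeg : ∀ i, (l i).natDegree = Fintype.card ι - 1 := fun i =>
    Lagrange.natDegree_basis hinj.injOn (Finset.mem_univ _)
  have hpos : ∀ _ : ι, 0 < Fintype.card ι := fun i => Fintype.card_pos_iff.mpr ⟨i⟩
  -- For `P` of degree below the number of nodes `a`, `O` carries the weighted values `α i * P (a
  -- i)` to `β j * P (b j)`. It is orthogonal because the divided difference kills `l i * l k`; one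
  -- more factor `X` reaches the top degree, and the coefficient that appears there is the rank-one
  -- term `vecMulVec v v`.
  set O : Matrix ι ι ℝ := of fun j i => β j * (l i).eval (b j) / α i with hO
  set v : ι → ℝ := fun i => (l i).coeff (Fintype.card ι - 1) / α i with hv
  have hsumw : ∀ Q : ℝ[X], Q.degree < S.card →
      ∑ j, w (b j) * Q.eval (b j) = ∑ i, -w (a i) * Q.eval (a i) + Q.coeff (S.card - 1) := by
    intro Q hQ
    have h1 := sum_nodalWeight_mul_eval S hQ
    rw [hsum] at h1
    simp only [neg_mul, Finset.sum_neg_distrib]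
    linarith
  have hprod : ∀ i k, (l i * l k).natDegree ≤ 2 * (Fintype.card ι - 1) := fun i k => by
    refine natDegree_mul_le.trans ?_
    rw [hldeg, hldeg]; omega
  have hOO : Oᵀ * O = 1 := by
    ext i k
    have h1 : (l i * l k).degree < S.card := by
      refine degree_le_natDegree.trans_lt ?_
      have := hprod i k; have := hpos i
      rw [hcard]; exact_mod_cast (by omega)
    have h2 := hsumw _ h1
    rw [coeff_eq_zero_of_natDegree_lt (by have := hprod i k; have := hpos i; omega), add_zero] at h2
    have h3 : (Oᵀ * O) i k = (∑ j, w (b j) * (l i * l k).eval (b j)) / (α i * α k) := by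
      simp only [Matrix.mul_apply, transpose_apply, hO, of_apply, Finset.sum_div, eval_mul]
      refine Finset.sum_congr rfl fun j _ => ?_
      rw [← hβ2]; have := hα0 i; have := hα0 k; field_simp
    rw [h3, h2]
    simp only [eval_mul, hla, one_apply]
    by_cases h : i = k
    · subst h
      simp [hα2, (hwa i).ne]
    · rw [Finset.sum_eq_zero, zero_div, if_neg h]
      intro j _
      by_cases h' : i = j
      · subst h'; simp [Ne.symm h]
      · simp [h']
  have hOv : Oᵀ * diagonal b * O - diagonal a = vecMulVec v v := by
    ext i k
    have h0 : (X * (l i * l k)).natDegree ≤ 2 * Fintype.card ι - 1 := by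
      refine natDegree_mul_le.trans ?_
      have := hprod i k; have := hpos i
      rw [natDegree_X]; omega
    have h1 : (X * (l i * l k)).degree < (S.card : WithBot ℕ) := by
      refine degree_le_natDegree.trans_lt ?_
      have := hpos i
      rw [hcard]; exact_mod_cast (by omega)
    have h2 := hsumw _ h1
    have h4 : (X * (l i * l k)).coeff (S.card - 1)
        = (l i).coeff (Fintype.card ι - 1) * (l k).coeff (Fintype.card ι - 1) := by
      have := hpos i
      rw [show S.card - 1 = ((Fintype.card ι - 1) + (Fintype.card ι - 1)) + 1 by omega, coeff_X_mul]
      exact coeff_mul_add_eq_of_natDegree_le (hldeg i).le (hldeg k).le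
    rw [h4] at h2
    have h3 : (Oᵀ * diagonal b * O) i k
        = (∑ j, w (b j) * (X * (l i * l k)).eval (b j)) / (α i * α k) := by
      rw [Matrix.mul_apply]
      simp only [mul_diagonal, transpose_apply, hO, of_apply, Finset.sum_div, eval_mul, eval_X]
      refine Finset.sum_congr rfl fun j _ => ?_
      rw [← hβ2]; have := hα0 i; have := hα0 k; field_simp
    rw [Matrix.sub_apply, h3, h2, vecMulVec_apply]
    have h5 : ∑ j, -w (a j) * (X * (l i * l k)).eval (a j) = diagonal a i k * (α i * α k) := by
      simp only [eval_mul, eval_X, hla, diagonal_apply]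
      by_cases h : i = k
      · subst h
        simp [hα2]; ring
      · rw [Finset.sum_eq_zero, if_neg h, zero_mul]
        intro j _
        by_cases h' : i = j
        · subst h'; simp [Ne.symm h]
        · simp [h']
    rw [h5, hv]
    have := hα0 i; have := hα0 k
    field_simp
    ring
  have key := hf.sum_le_sum ha hb hOO hOv fun i => α i * P.eval (a i)
  have hOx : ∀ j, (O *ᵥ fun i => α i * P.eval (a i)) j = β j * P.eval (b j) := by
    intro j
    have h1 : P = Lagrange.interpolate Finset.univ a fun i => P.eval (a i) :=
      Lagrange.eq_interpolate hinj.injOn (by simpa using hP)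
    conv_rhs => rw [h1, Lagrange.interpolate_apply, eval_finsetSum, Finset.mul_sum]
    simp only [mulVec, dotProduct, hO, of_apply, eval_mul, eval_C]
    refine Finset.sum_congr rfl fun i _ => ?_
    have := hα0 i
    field_simp
    ring
  simp only [hOx] at key
  rw [hsum]
  have e1 : ∑ i, w (a i) * (P.eval (a i) ^ 2 * f (a i))
      = -∑ i, f (a i) * (α i * P.eval (a i)) ^ 2 := by
    rw [← Finset.sum_neg_distrib]
    refine Finset.sum_congr rfl fun i _ => ?_
    rw [mul_pow, pow_two (α i), hα2]; ring
  have e2 : ∑ i, w (b i) * (P.eval (b i) ^ 2 * f (b i))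
      = ∑ i, f (b i) * (β i * P.eval (b i)) ^ 2 := by
    refine Finset.sum_congr rfl fun i _ => ?_
    rw [mul_pow, pow_two (β i), hβ2]; ring
  rw [e1, e2]
  linarith

/-- Loewner's inequality: for an operator monotone function `f`, an even number `2 * m` of nodes and
a polynomial `P` of degree less than `m`, the divided difference of `P ^ 2 * f` is nonnegative. -/
theorem IsOperatorMonotoneOn.sum_nodalWeight_nonneg {f : ℝ → ℝ} {I : Set ℝ}
    (hf : IsOperatorMonotoneOn.{u} f I) {S : Finset ℝ} (hSI : ∀ t ∈ S, t ∈ I) {m : ℕ}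
    (hS : S.card = 2 * m) {P : ℝ[X]} (hP : P.degree < m) :
    0 ≤ ∑ t ∈ S, Lagrange.nodalWeight S id t * (P.eval t ^ 2 * f t) := by
  set e := S.orderEmbOfFin hS with he
  have hmem : ∀ i, e i ∈ S := fun i => S.orderEmbOfFin_mem hS i
  -- In increasing order the weights alternate, and the largest node has positive weight; counting
  -- from zero, even positions are negative and odd ones positive. `ULift` places the index type in
  -- the universe of the hypothesis.
  let p : ULift.{u} (Fin m) → Fin (2 * m) := fun i => ⟨2 * i.down, by omega⟩
  let q : ULift.{u} (Fin m) → Fin (2 * m) := fun i => ⟨2 * i.down + 1, by omega⟩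
  refine hf.sum_nodalWeight_nonneg_of_sign (ι := ULift.{u} (Fin m)) (a := fun i => e (p i))
    (b := fun i => e (q i)) (fun i => hSI _ (hmem _)) (fun i => hSI _ (hmem _)) ?_ S ?_ ?_ ?_
    (by simpa using hP)
  · intro i k hik
    have := congrArg Fin.val (e.injective hik)
    simp only [p] at this
    ext
    omega
  · intro g
    have h1 : ∑ t ∈ S, g t = ∑ i, g (e i) := by
      have hSe : S = Finset.univ.map e.toEmbedding := (S.map_orderEmbOfFin_univ hS).symm
      conv_lhs => rw [hSe]
      rw [Finset.sum_map]
      rfl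
    have h2 := Fintype.sum_sum_type fun s => g (e (Sum.elim p q s))
    simp only [Sum.elim_inl, Sum.elim_inr] at h2
    rw [h1, ← h2]
    symm
    refine Fintype.sum_bijective (Sum.elim p q) ⟨?_, ?_⟩ _ _ fun _ => rfl
    · rintro (⟨i⟩ | ⟨i⟩) (⟨k⟩ | ⟨k⟩) h <;> have := congrArg Fin.val h <;>
        simp only [Sum.elim_inl, Sum.elim_inr, p, q] at this <;>
        first | omega | (congr 2; ext; omega)
    · intro k
      rcases Nat.even_or_odd' (k : ℕ) with ⟨c, hc | hc⟩
      · exact ⟨Sum.inl ⟨⟨c, by omega⟩⟩, Fin.ext hc.symm⟩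
      · exact ⟨Sum.inr ⟨⟨c, by omega⟩⟩, Fin.ext hc.symm⟩
  · intro i
    have := nodalWeight_univ_sign e.strictMono (p i)
    rw [← nodalWeight_orderEmbOfFin, Odd.neg_one_pow] at this
    · linarith
    · simp only [p]
      exact ⟨m - 1 - i.down, by omega⟩
  · intro i
    have := nodalWeight_univ_sign e.strictMono (q i)
    rw [← nodalWeight_orderEmbOfFin, Even.neg_one_pow] at this
    · linarith
    · simp only [q]
      exact ⟨m - 1 - i.down, by omega⟩

/-! ### Linear growth and the inequality for `f t / t` -/

theorem sum_nodalWeight_insert {S : Finset ℝ} {x : ℝ} (hx : x ∉ S) (g : ℝ → ℝ) :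
    ∑ t ∈ insert x S, Lagrange.nodalWeight (insert x S) id t * g t =
      (∏ s ∈ S, (x - s)⁻¹) * g x +
        ∑ t ∈ S, Lagrange.nodalWeight S id t * ((t - x)⁻¹ * g t) := by
  rw [Finset.sum_insert hx]
  congr 1
  · rw [Lagrange.nodalWeight, Finset.erase_insert hx]
    rfl
  · refine Finset.sum_congr rfl fun t ht => ?_
    have htx : x ≠ t := fun h => hx (h ▸ ht)
    rw [Lagrange.nodalWeight, Finset.erase_insert_of_ne htx,
      Finset.prod_insert fun h => hx (Finset.mem_of_mem_erase h), Lagrange.nodalWeight]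
    simp only [id]
    ring

/-- A positive operator monotone function on the half-line grows at most linearly. -/
theorem IsOperatorMonotoneOn.le_linear {f : ℝ → ℝ} (hf : IsOperatorMonotoneOn.{u} f (Set.Ioi 0))
    (hpos : ∀ t, 0 < t → 0 < f t) {a r : ℝ} (ha : 0 < a) (har : a < r) :
    f r ≤ 4 * f a / a * r := by
  -- Loewner's inequality on the nodes `d < a < r < L` with `P = X - L`: the node `L` drops out, and
  -- the term at `d` has a sign that allows discarding it. Halving `a` and doubling `r` produces the
  -- constant `4`.
  set d := a / 2 with hd
  set L := 2 * r with hL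
  have hda : d < a := by rw [hd]; linarith
  have hrL : r < L := by rw [hL]; linarith
  have hd0 : 0 < d := by positivity
  have n1 : d ∉ ({a, r, L} : Finset ℝ) := by
    simp only [Finset.mem_insert, Finset.mem_singleton, not_or]
    exact ⟨hda.ne, (hda.trans har).ne, (hda.trans (har.trans hrL)).ne⟩
  have n2 : a ∉ ({r, L} : Finset ℝ) := by
    simp only [Finset.mem_insert, Finset.mem_singleton, not_or]
    exact ⟨har.ne, (har.trans hrL).ne⟩
  have n3 : r ∉ ({L} : Finset ℝ) := by
    simpa using hrL.ne
  have hcard : (insert d {a, r, L} : Finset ℝ).card = 2 * 2 := by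
    rw [Finset.card_insert_of_notMem n1, Finset.card_insert_of_notMem n2,
      Finset.card_insert_of_notMem n3, Finset.card_singleton]
  have key := hf.sum_nodalWeight_nonneg (S := insert d {a, r, L}) (m := 2) (P := X - C L)
    (by simp only [Finset.mem_insert, Finset.mem_singleton, Set.mem_Ioi]
        rintro t (rfl | rfl | rfl | rfl) <;> linarith)
    hcard (by rw [degree_X_sub_C]; norm_num)
  rw [sum_nodalWeight_insert n1, sum_nodalWeight_insert n2, sum_nodalWeight_insert n3,
    Finset.sum_singleton, Finset.prod_insert n2, Finset.prod_insert n3, Finset.prod_insert n3] at key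
  simp only [Finset.prod_singleton, eval_sub, eval_X, eval_C, sub_self] at key
  have p1 : 0 < a - d := sub_pos.mpr hda
  have p2 : 0 < r - a := sub_pos.mpr har
  have p3 : 0 < L - r := sub_pos.mpr hrL
  have p4 : 0 < r - d := by linarith
  have p5 : 0 < L - a := by linarith
  have p6 : 0 < L - d := by linarith
  have e : ((d - a)⁻¹ * ((d - r)⁻¹ * (d - L)⁻¹)) * ((d - L) ^ 2 * f d) +
      ((a - r)⁻¹ * (a - L)⁻¹ * ((a - d)⁻¹ * ((a - L) ^ 2 * f a)) +
      (r - L)⁻¹ * ((r - a)⁻¹ * ((r - d)⁻¹ * ((r - L) ^ 2 * f r)))) =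
      -((L - d) * f d / ((a - d) * (r - d))) + (L - a) * f a / ((a - d) * (r - a))
        - (L - r) * f r / ((r - d) * (r - a)) := by
    rw [← neg_sub a d, ← neg_sub r d, ← neg_sub L d, ← neg_sub r a, ← neg_sub L a, ← neg_sub L r]
    field_simp
    ring
  have key2 : (L - r) * f r / ((r - d) * (r - a)) ≤ (L - a) * f a / ((a - d) * (r - a)) := by
    have h1 : 0 < (L - d) * f d / ((a - d) * (r - d)) := by
      have := hpos d hd0
      positivity
    have h2 : 0 ≤ ((d - a)⁻¹ * ((d - r)⁻¹ * (d - L)⁻¹)) * ((d - L) ^ 2 * f d) +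
      ((a - r)⁻¹ * (a - L)⁻¹ * ((a - d)⁻¹ * ((a - L) ^ 2 * f a)) +
      (r - L)⁻¹ * ((r - a)⁻¹ * ((r - d)⁻¹ * ((r - L) ^ 2 * f r)))) := by
      refine key.trans_eq ?_
      simp
    linarith
  rw [div_le_div_iff₀ (by positivity) (by positivity)] at key2
  have key3 : (L - r) * f r * (a - d) ≤ (L - a) * f a * (r - d) := by
    refine le_of_mul_le_mul_right ?_ p2
    linarith
  have hfa := hpos a ha
  have hr0 : 0 < r := ha.trans har
  have key4 : r * f r * (a / 2) ≤ 2 * r * f a * r := by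
    have e1 : L - r = r := by rw [hL]; ring
    have e2 : a - d = a / 2 := by rw [hd]; ring
    rw [e1, e2] at key3
    refine key3.trans ?_
    have : (L - a) * f a ≤ 2 * r * f a := mul_le_mul_of_nonneg_right (by linarith) hfa.le
    exact mul_le_mul this (by linarith) p4.le (by positivity)
  rw [div_mul_eq_mul_div, le_div_iff₀ ha]
  refine le_of_mul_le_mul_left ?_ hr0
  linarith

/-- A node `d` to the left of `S` contributes the factor `(t - d)⁻¹`. A node `x` contributes `(t -
x)⁻¹`, which after multiplication by `x` tends to `-1` and reverses the inequality. -/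
theorem IsOperatorMonotoneOn.sum_nodalWeight_div_sub_nonpos {f : ℝ → ℝ}
    (hf : IsOperatorMonotoneOn.{u} f (Set.Ioi 0)) (hpos : ∀ t, 0 < t → 0 < f t) {S : Finset ℝ}
    {m : ℕ} (hS : S.card = 2 * m) {P : ℝ[X]} (hP : P.degree < m) {d : ℝ} (hd : 0 < d)
    (hdS : ∀ t ∈ S, d < t) :
    ∑ t ∈ S, Lagrange.nodalWeight S id t * ((t - d)⁻¹ * (P.eval t ^ 2 * f t)) ≤ 0 := by
  have hdn : d ∉ S := fun h => (hdS d h).false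
  have hdprod : 0 ≤ ∏ s ∈ S, (d - s)⁻¹ := by
    have : ∏ s ∈ S, (d - s)⁻¹ = ∏ s ∈ S, (s - d)⁻¹ := by
      calc ∏ s ∈ S, (d - s)⁻¹ = ∏ s ∈ S, (-1) * (s - d)⁻¹ := by
            refine Finset.prod_congr rfl fun s _ => ?_
            rw [← neg_sub s d, inv_neg, neg_one_mul]
        _ = _ := by
            rw [Finset.prod_mul_distrib, Finset.prod_const, hS, pow_mul]
            simp
    rw [this]
    exact Finset.prod_nonneg fun s hs => inv_nonneg.mpr (sub_nonneg.mpr (hdS s hs).le)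
  -- the inequality obtained by adding the nodes `d` and `x`
  have hx : ∀ᶠ x in atTop, 0 ≤ f x / (x - d) * ((X * P ^ 2).eval x / (Lagrange.nodal S id).eval x)
      + ∑ t ∈ S, Lagrange.nodalWeight S id t *
          ((t - d)⁻¹ * ((x / (t - x)) * (P.eval t ^ 2 * f t))) := by
    have hSx : ∀ᶠ x in atTop, ∀ t ∈ S, t < x := by
      rw [Filter.eventually_all_finset]
      exact fun t _ => eventually_gt_atTop t
    filter_upwards [hSx, eventually_gt_atTop d] with x hxS hxd
    have hxn : x ∉ insert d S := by
      rw [Finset.mem_insert, not_or]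
      exact ⟨hxd.ne', fun h => (hxS x h).false⟩
    have hx0 : 0 < x := hd.trans hxd
    have key := hf.sum_nodalWeight_nonneg (S := insert x (insert d S)) (m := m + 1) (P := P)
      (by
        intro t ht
        rcases Finset.mem_insert.mp ht with rfl | ht
        · exact hx0
        · rcases Finset.mem_insert.mp ht with rfl | ht
          · exact hd
          · exact hd.trans (hdS t ht))
      (by rw [Finset.card_insert_of_notMem hxn, Finset.card_insert_of_notMem hdn, hS]; ring)
      (hP.trans (by exact_mod_cast Nat.lt_succ_self m))
    rw [sum_nodalWeight_insert hxn, sum_nodalWeight_insert hdn, Finset.prod_insert hdn] at key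
    -- The term at `d` is nonpositive by positivity of `f` and evenness of `S.card`, so dropping it
    -- preserves the inequality.
    have h1 : (∏ s ∈ S, (d - s)⁻¹) * ((d - x)⁻¹ * (P.eval d ^ 2 * f d)) ≤ 0 := by
      refine mul_nonpos_of_nonneg_of_nonpos hdprod (mul_nonpos_of_nonpos_of_nonneg ?_ ?_)
      · exact inv_nonpos.mpr (sub_nonpos.mpr hxd.le)
      · exact mul_nonneg (sq_nonneg _) (hpos d hd).le
    have h2 := mul_nonneg hx0.le (key.trans (add_le_add_right (add_le_add_left h1 _) _))
    refine h2.trans_eq ?_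
    rw [zero_add, mul_add, Finset.mul_sum, Lagrange.eval_nodal, Finset.prod_inv_distrib]
    congr 1
    · simp only [eval_mul, eval_X, eval_pow, id]
      ring
    · refine Finset.sum_congr rfl fun t _ => ?_
      ring
  -- Linear growth bounds `f x / (x - d)`, so this degree gap makes the term at `x` vanish in the
  -- limit.
  have hdeg : (X * P ^ 2).degree < (Lagrange.nodal S (id : ℝ → ℝ)).degree := by
    rw [Lagrange.degree_nodal, hS]
    by_cases hP0 : P = 0
    · simp only [hP0, ne_eq, OfNat.ofNat_ne_zero, not_false_eq_true, zero_pow, mul_zero, degree_zero]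
      exact WithBot.bot_lt_coe _
    · have h1 : P.natDegree < m := by
        rw [degree_eq_natDegree hP0] at hP
        exact_mod_cast hP
      rw [degree_mul, degree_pow, degree_X, degree_eq_natDegree hP0]
      rw [← Nat.cast_one, nsmul_eq_mul]
      norm_cast
      omega
  have hlim1 : Tendsto (fun x => f x / (x - d) *
      ((X * P ^ 2).eval x / (Lagrange.nodal S id).eval x)) atTop (𝓝 0) := by
    refine bdd_le_mul_tendsto_zero' (2 * (4 * f d / d)) ?_ 
      (div_tendsto_atTop_zero_of_degree_lt _ _ hdeg)
    filter_upwards [eventually_gt_atTop (2 * d)] with x hx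
    have hx0 : 0 < x - d := by linarith
    rw [abs_of_nonneg (div_nonneg (hpos x (by linarith)).le hx0.le), div_le_iff₀ hx0]
    refine (hf.le_linear hpos hd (by linarith)).trans ?_
    have h4 : 0 < 4 * f d / d := by have := hpos d hd; positivity
    rw [mul_comm 2, mul_assoc]
    exact mul_le_mul_of_nonneg_left (by linarith) h4.le
  have hlim2 : ∀ t : ℝ, Tendsto (fun x : ℝ => x / (t - x)) atTop (𝓝 (-1)) := by
    intro t
    have h1 : Tendsto (fun x : ℝ => t / (t - x) - 1) atTop (𝓝 (0 - 1)) := by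
      refine Tendsto.sub_const ?_ _
      refine Tendsto.div_atBot tendsto_const_nhds ?_
      exact (tendsto_atBot_add_const_left atTop t tendsto_neg_atTop_atBot).congr fun x => by ring
    rw [zero_sub] at h1
    refine h1.congr' ?_
    filter_upwards [eventually_gt_atTop t] with x hx
    have : t - x ≠ 0 := (sub_neg.mpr hx).ne
    field_simp
    ring
  have hlim := hlim1.add (tendsto_finsetSum S fun t _ =>
    (((hlim2 t).mul_const (P.eval t ^ 2 * f t)).const_mul ((t - d)⁻¹)).const_mul
      (Lagrange.nodalWeight S id t))
  have h := ge_of_tendsto hlim hx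
  simp only [neg_mul, one_mul, mul_neg, Finset.sum_neg_distrib, zero_add] at h
  linarith

/-- The counterpart of Loewner's inequality for `t ↦ f t / t`, where `f` is positive and operator
monotone on the half-line. -/
theorem IsOperatorMonotoneOn.sum_nodalWeight_div_nonpos {f : ℝ → ℝ}
    (hf : IsOperatorMonotoneOn.{u} f (Set.Ioi 0)) (hpos : ∀ t, 0 < t → 0 < f t) {S : Finset ℝ}
    (hS0 : ∀ t ∈ S, 0 < t) {m : ℕ} (hS : S.card = 2 * m) {P : ℝ[X]} (hP : P.degree < m) :
    ∑ t ∈ S, Lagrange.nodalWeight S id t * (t⁻¹ * (P.eval t ^ 2 * f t)) ≤ 0 := by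
  have hlim : Tendsto (fun d : ℝ => ∑ t ∈ S, Lagrange.nodalWeight S id t *
      ((t - d)⁻¹ * (P.eval t ^ 2 * f t))) (𝓝[>] 0)
      (𝓝 (∑ t ∈ S, Lagrange.nodalWeight S id t * ((t - 0)⁻¹ * (P.eval t ^ 2 * f t)))) := by
    refine tendsto_finsetSum S fun t ht => Tendsto.const_mul _ (Tendsto.mul_const _ ?_)
    refine Tendsto.inv₀ ?_ (by simpa using (hS0 t ht).ne')
    exact tendsto_const_nhds.sub (tendsto_id.mono_left nhdsWithin_le_nhds)
  simp only [sub_zero] at hlim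
  refine le_of_tendsto hlim ?_
  have h1 : ∀ᶠ d : ℝ in 𝓝[>] 0, ∀ t ∈ S, d < t := by
    rw [Filter.eventually_all_finset]
    exact fun t ht => nhdsWithin_le_nhds (eventually_lt_nhds (hS0 t ht))
  filter_upwards [h1, self_mem_nhdsWithin] with d hd hd0
  exact hf.sum_nodalWeight_div_sub_nonpos hpos hS hP hd0 hd

/-! ### Sums of squares and polynomials nonnegative on the half-line -/

theorem Polynomial.degree_add_eq_max_of_leadingCoeff_nonneg {p q : ℝ[X]} (hp : 0 ≤ p.leadingCoeff)
    (hq : 0 ≤ q.leadingCoeff) :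
    (p + q).degree = max p.degree q.degree ∧ 0 ≤ (p + q).leadingCoeff := by
  rcases lt_trichotomy p.degree q.degree with h | h | h
  · rw [degree_add_eq_right_of_degree_lt h, leadingCoeff_add_of_degree_lt h, max_eq_right h.le]
    exact ⟨rfl, hq⟩
  · by_cases h0 : p.leadingCoeff + q.leadingCoeff = 0
    · have hp0 : p = 0 := leadingCoeff_eq_zero.mp (by linarith)
      have hq0 : q = 0 := leadingCoeff_eq_zero.mp (by linarith)
      simp [hp0, hq0]
    · rw [leadingCoeff_add_of_degree_eq h h0]
      exact ⟨degree_add_eq_of_leadingCoeff_add_ne_zero h0, add_nonneg hp hq⟩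
  · rw [degree_add_eq_left_of_degree_lt h, leadingCoeff_add_of_degree_lt' h, max_eq_left h.le]
    exact ⟨rfl, hp⟩

theorem IsSumSq.leadingCoeff_nonneg {s : ℝ[X]} (hs : IsSumSq s) : 0 ≤ s.leadingCoeff := by
  induction hs with
  | zero => simp
  | sq_add a _ ih =>
    exact (degree_add_eq_max_of_leadingCoeff_nonneg
      (by rw [leadingCoeff_mul]; exact mul_self_nonneg _) ih).2

/-- Leading terms of squares cannot cancel, so the degree bound on the sum passes to every summand.
-/
theorem IsSumSq.map_nonneg {s : ℝ[X]} (hs : IsSumSq s) {m : ℕ} (hdeg : s.degree < (2 * m : ℕ))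
    {Λ : ℝ[X] →ₗ[ℝ] ℝ} (hΛ : ∀ p : ℝ[X], p.degree < m → 0 ≤ Λ (p ^ 2)) : 0 ≤ Λ s := by
  induction hs with
  | zero => simp
  | sq_add a hs ih =>
    rw [(degree_add_eq_max_of_leadingCoeff_nonneg
      (by rw [leadingCoeff_mul]; exact mul_self_nonneg _) hs.leadingCoeff_nonneg).1,
      max_lt_iff] at hdeg
    rw [map_add, ← pow_two]
    refine add_nonneg (hΛ a ?_) (ih hdeg.2)
    by_cases ha : a = 0
    · rw [ha, degree_zero]; exact WithBot.bot_lt_coe _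
    · have h := hdeg.1
      rw [degree_mul, degree_eq_natDegree ha] at h
      rw [degree_eq_natDegree ha]
      norm_cast at h ⊢
      omega

/-- A real polynomial that is nonnegative on the half-line is `σ₀ + X * σ₁` with sums of squares
`σ₀` and `σ₁`. -/
theorem Polynomial.exists_isSumSq_of_nonneg_Ioi (N : ℝ[X]) (hN : ∀ x, 0 < x → 0 ≤ N.eval x) :
    ∃ σ₀ σ₁ : ℝ[X], IsSumSq σ₀ ∧ IsSumSq σ₁ ∧ N = σ₀ + X * σ₁ := by
  -- Closure under products, with `X * X` absorbed as a square, allows splitting off one factor at a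
  -- time.
  have hmul : ∀ M K : ℝ[X],
      (∃ σ₀ σ₁ : ℝ[X], IsSumSq σ₀ ∧ IsSumSq σ₁ ∧ M = σ₀ + X * σ₁) →
      (∃ σ₀ σ₁ : ℝ[X], IsSumSq σ₀ ∧ IsSumSq σ₁ ∧ K = σ₀ + X * σ₁) →
      ∃ σ₀ σ₁ : ℝ[X], IsSumSq σ₀ ∧ IsSumSq σ₁ ∧ M * K = σ₀ + X * σ₁ := by
    rintro _ _ ⟨s₀, s₁, hs₀, hs₁, rfl⟩ ⟨r₀, r₁, hr₀, hr₁, rfl⟩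
    exact ⟨s₀ * r₀ + X * X * (s₁ * r₁), s₀ * r₁ + s₁ * r₀,
      (hs₀.mul hr₀).add ((IsSumSq.mul_self _).mul (hs₁.mul hr₁)),
      (hs₀.mul hr₁).add (hs₁.mul hr₀), by ring⟩
  have hconst : ∀ c : ℝ, 0 ≤ c → IsSumSq (C c) := fun c hc => by
    rw [← Real.mul_self_sqrt hc, C_mul]
    exact IsSumSq.mul_self _
  induction hn : N.natDegree using Nat.strong_induction_on generalizing N with
  | _ n ih =>
    subst hn
    have step : ∀ D M : ℝ[X], N = D * M → 0 < D.natDegree → N ≠ 0 →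
        (∀ x, 0 < x → 0 ≤ M.eval x) →
        (∃ σ₀ σ₁ : ℝ[X], IsSumSq σ₀ ∧ IsSumSq σ₁ ∧ D = σ₀ + X * σ₁) →
        ∃ σ₀ σ₁ : ℝ[X], IsSumSq σ₀ ∧ IsSumSq σ₁ ∧ N = σ₀ + X * σ₁ := by
      intro D M hDM hD hN0 hM hDs
      have hlt : M.natDegree < N.natDegree := by
        rw [hDM, natDegree_mul (left_ne_zero_of_mul (hDM ▸ hN0))
          (right_ne_zero_of_mul (hDM ▸ hN0))]
        omega
      rw [hDM]
      exact hmul D M hDs (ih _ hlt M hM rfl)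
    rcases Nat.eq_zero_or_pos N.natDegree with h0 | h0
    · rw [eq_C_of_natDegree_eq_zero h0] at hN ⊢
      refine ⟨_, 0, hconst _ (by simpa using hN 1 one_pos), IsSumSq.zero, by simp⟩
    have hN0 : N ≠ 0 := by rintro rfl; simp at h0
    obtain ⟨z, hz⟩ := IsAlgClosed.exists_aeval_eq_zero ℂ N
      (by rw [degree_eq_natDegree hN0]; exact_mod_cast h0.ne')
    by_cases him : z.im = 0
    · set r := z.re with hr
      have hroot : N.IsRoot r := by
        have h1 : ((r : ℝ) : ℂ) = z := Complex.ext rfl (by simp [him])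
        rw [← h1, ← Complex.coe_algebraMap, aeval_algebraMap_apply] at hz
        simpa using hz
      obtain ⟨M, hM⟩ := dvd_iff_isRoot.mpr hroot
      have hev : ∀ x, N.eval x = (x - r) * M.eval x := fun x => by
        conv_lhs => rw [hM]
        simp
      -- A root `r ≤ 0` gives the factor `-r + X * 1`. At a root `r > 0` the sign may not change, so
      -- `(X - r) ^ 2` divides `N`.
      rcases le_or_gt r 0 with hr0 | hr0
      · refine step _ M hM (by simp) hN0 (fun x hx => ?_) ⟨C (-r), 1, hconst _ (by linarith),
          IsSumSq.one, by simp; ring⟩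
        have := hN x hx
        rw [hev] at this
        exact nonneg_of_mul_nonneg_right this (by linarith)
      · have hMr : M.eval r = 0 := by
          refine le_antisymm ?_ ?_
          · have hlim : Tendsto (fun x => M.eval x) (𝓝[<] r) (𝓝 (M.eval r)) :=
              (M.continuous.tendsto r).mono_left nhdsWithin_le_nhds
            refine le_of_tendsto hlim ?_
            filter_upwards [self_mem_nhdsWithin, nhdsWithin_le_nhds (eventually_gt_nhds hr0)]
              with x hx hx0
            have := hN x hx0
            rw [hev] at this
            exact nonpos_of_mul_nonneg_right this (sub_neg.mpr hx)
          · have hlim : Tendsto (fun x => M.eval x) (𝓝[>] r) (𝓝 (M.eval r)) :=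
              (M.continuous.tendsto r).mono_left nhdsWithin_le_nhds
            refine ge_of_tendsto hlim ?_
            filter_upwards [self_mem_nhdsWithin] with x hx
            have := hN x (hr0.trans hx)
            rw [hev] at this
            exact nonneg_of_mul_nonneg_right this (sub_pos.mpr hx)
        obtain ⟨K, hK⟩ := dvd_iff_isRoot.mpr (show M.IsRoot r from hMr)
        have hNK : N = (X - C r) * (X - C r) * K := by rw [mul_assoc, ← hK, ← hM]
        refine step _ K hNK (by rw [natDegree_mul (X_sub_C_ne_zero r) (X_sub_C_ne_zero r)]; simp)
          hN0 ?_ ⟨_, 0, IsSumSq.mul_self (X - C r), IsSumSq.zero, by simp⟩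
        have hne : ∀ x, 0 < x → x ≠ r → 0 ≤ K.eval x := fun x hx hxr => by
          have := hN x hx
          rw [hNK, eval_mul, eval_mul, eval_sub, eval_X, eval_C] at this
          exact nonneg_of_mul_nonneg_right this (mul_self_pos.mpr (sub_ne_zero.mpr hxr))
        intro x hx
        by_cases hxr : x = r
        · have hlim : Tendsto (fun y => K.eval y) (𝓝[>] r) (𝓝 (K.eval r)) :=
            (K.continuous.tendsto r).mono_left nhdsWithin_le_nhds
          rw [hxr]
          refine ge_of_tendsto hlim ?_
          filter_upwards [self_mem_nhdsWithin] with y hy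
          exact hne y (hr0.trans hy) (ne_of_gt hy)
        · exact hne x hx hxr
    · obtain ⟨M, hM⟩ := N.quadratic_dvd_of_aeval_eq_zero_im_ne_zero hz him
      have hD : X ^ 2 - C (2 * z.re) * X + C (‖z‖ ^ 2)
          = (X - C z.re) * (X - C z.re) + C z.im * C z.im := by
        rw [← Complex.normSq_eq_norm_sq, Complex.normSq_apply]
        simp only [map_mul, map_add, map_ofNat]
        ring
      rw [hD] at hM
      refine step _ M hM ?_ hN0 (fun x hx => ?_)
        ⟨_, 0, (IsSumSq.mul_self (X - C z.re)).add (IsSumSq.mul_self (C z.im)), IsSumSq.zero,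
          by simp⟩
      · rw [← C_mul, natDegree_add_C, natDegree_mul (X_sub_C_ne_zero _) (X_sub_C_ne_zero _)]
        simp
      · have := hN x hx
        rw [hM, eval_mul] at this
        refine nonneg_of_mul_nonneg_right this ?_
        simp only [eval_add, eval_mul, eval_sub, eval_X, eval_C]
        exact add_pos_of_nonneg_of_pos (mul_self_nonneg _) (mul_self_pos.mpr him)

/-! ### Duality and approximation by rational functions -/

/-- The dual description of positive operator monotone functions on the half-line: a finite linear
functional that is nonnegative on all functions `t ↦ t / (t + x)` is nonnegative on them. -/
theorem IsOperatorMonotoneOn.sum_mul_nonneg_of_card {f : ℝ → ℝ}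
    (hf : IsOperatorMonotoneOn.{u} f (Set.Ioi 0)) (hpos : ∀ t, 0 < t → 0 < f t) {S : Finset ℝ}
    (hS0 : ∀ t ∈ S, 0 < t) {m : ℕ} (hS : S.card = 2 * m) {c : ℝ → ℝ}
    (hc : ∀ x, 0 < x → 0 ≤ ∑ t ∈ S, c t * (t / (t + x))) : 0 ≤ ∑ t ∈ S, c t * f t := by
  set N : ℝ[X] := ∑ t ∈ S, C (c t * t) * ∏ s ∈ S.erase t, (X + C s) with hNdef
  have hNpos : ∀ x, 0 < x → 0 ≤ N.eval x := by
    intro x hx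
    have h1 : N.eval x = (∏ s ∈ S, (x + s)) * ∑ t ∈ S, c t * (t / (t + x)) := by
      rw [hNdef, eval_finsetSum, Finset.mul_sum]
      refine Finset.sum_congr rfl fun t ht => ?_
      rw [eval_mul, eval_C, eval_prod, ← Finset.mul_prod_erase S _ ht]
      simp only [eval_add, eval_X, eval_C]
      have := hS0 t ht
      field_simp
      ring
    rw [h1]
    exact mul_nonneg (Finset.prod_nonneg fun s hs => (add_pos hx (hS0 s hs)).le) (hc x hx)
  have hNdeg : N.degree < (2 * m : ℕ) := by
    rcases S.eq_empty_or_nonempty with rfl | hne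
    · simp only [hNdef, Finset.sum_empty, degree_zero]
      exact WithBot.bot_lt_coe _
    · have hcard := hne.card_pos
      have h1 : N.natDegree ≤ 2 * m - 1 := by
        refine natDegree_sum_le_of_forall_le _ _ fun t ht => ?_
        refine (natDegree_C_mul_le _ _).trans ((natDegree_prod_le _ _).trans ?_)
        simp [Finset.card_erase_of_mem ht, hS]
      refine degree_le_natDegree.trans_lt ?_
      exact_mod_cast (by omega)
  -- The poles of `t / (t + x)` in `x` lie at `-t`, hence evaluation there. On `p ^ 2` nonnegativity
  -- of `Λ` is the inequality for `f t / t`; on `X * p ^ 2` the factor `-t` cancels `t⁻¹` and the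
  -- sign, leaving Loewner's inequality.
  let Λ : ℝ[X] →ₗ[ℝ] ℝ :=
    ∑ t ∈ S, (-(Lagrange.nodalWeight S id t * (t⁻¹ * f t))) • (aeval (-t)).toLinearMap
  have hΛ : ∀ Q, Λ Q = -∑ t ∈ S, Lagrange.nodalWeight S id t * (t⁻¹ * (Q.eval (-t) * f t)) := by
    intro Q
    simp only [Λ, LinearMap.sum_apply, LinearMap.smul_apply, AlgHom.toLinearMap_apply,
      coe_aeval_eq_eval, smul_eq_mul, ← Finset.sum_neg_distrib]
    exact Finset.sum_congr rfl fun t _ => by ring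
  have hcomp : ∀ p : ℝ[X], p.degree < m → (p.comp (-X)).degree < m := by
    intro p hp
    by_cases h : p = 0
    · simp [h]
    · refine degree_le_natDegree.trans_lt ?_
      rw [degree_eq_natDegree h] at hp
      rw [natDegree_comp, natDegree_neg, natDegree_X, mul_one]
      exact hp
  have hΛN : Λ N = ∑ t ∈ S, c t * f t := by
    rw [hΛ, ← Finset.sum_neg_distrib]
    refine Finset.sum_congr rfl fun t ht => ?_
    have h1 : N.eval (-t) = c t * t * ∏ s ∈ S.erase t, (-t + s) := by
      rw [hNdef, eval_finsetSum, Finset.sum_eq_single t]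
      · simp [eval_prod]
      · intro s hs hst
        rw [eval_mul, eval_prod, Finset.prod_eq_zero (Finset.mem_erase.mpr ⟨hst.symm, ht⟩),
          mul_zero]
        simp
      · exact fun h => absurd ht h
    have h2 : ∏ s ∈ S.erase t, (-t + s) = -∏ s ∈ S.erase t, (t - s) := by
      calc ∏ s ∈ S.erase t, (-t + s) = ∏ s ∈ S.erase t, (-1) * (t - s) :=
            Finset.prod_congr rfl fun s _ => by ring
        _ = _ := by
            have := Finset.card_pos.mpr ⟨t, ht⟩
            rw [Finset.prod_mul_distrib, Finset.prod_const, Finset.card_erase_of_mem ht, hS,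
              Odd.neg_one_pow ⟨m - 1, by omega⟩, neg_one_mul]
    have h3 : Lagrange.nodalWeight S id t * ∏ s ∈ S.erase t, (t - s) = 1 := by
      rw [Lagrange.nodalWeight, ← Finset.prod_mul_distrib]
      refine Finset.prod_eq_one fun s hs => ?_
      exact inv_mul_cancel₀ (sub_ne_zero.mpr (Finset.ne_of_mem_erase hs).symm)
    rw [h1, h2]
    have h4 : t⁻¹ * t = 1 := inv_mul_cancel₀ (hS0 t ht).ne'
    linear_combination (c t * f t) * (t⁻¹ * t) * h3 + c t * f t * h4
  obtain ⟨σ₀, σ₁, h₀, h₁, hN⟩ := exists_isSumSq_of_nonneg_Ioi N hNpos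
  have hX : (X * σ₁).leadingCoeff = σ₁.leadingCoeff := by simp
  rw [hN, (degree_add_eq_max_of_leadingCoeff_nonneg h₀.leadingCoeff_nonneg
    (hX ▸ h₁.leadingCoeff_nonneg)).1, max_lt_iff] at hNdeg
  rw [← hΛN, hN, map_add]
  refine add_nonneg (h₀.map_nonneg hNdeg.1 fun p hp => ?_) ?_
  · have := hf.sum_nodalWeight_div_nonpos hpos hS0 hS (hcomp p hp)
    rw [hΛ]
    simpa using this
  · have hdeg1 : σ₁.degree < (2 * m : ℕ) := by
      refine lt_of_le_of_lt ?_ hNdeg.2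
      rw [degree_mul, degree_X]
      exact le_add_of_nonneg_left zero_le_one
    refine h₁.map_nonneg (Λ := Λ ∘ₗ LinearMap.mulLeft ℝ X) hdeg1 fun p hp => ?_
    have := hf.sum_nodalWeight_nonneg hS0 hS (hcomp p hp)
    rw [LinearMap.comp_apply, LinearMap.mulLeft_apply, hΛ]
    refine this.trans_eq ?_
    rw [← Finset.sum_neg_distrib]
    refine Finset.sum_congr rfl fun t ht => ?_
    have h4 : t⁻¹ * t = 1 := inv_mul_cancel₀ (hS0 t ht).ne'
    simp only [eval_mul, eval_X, eval_pow, eval_comp, eval_neg]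
    linear_combination (-(Lagrange.nodalWeight S id t * eval (-t) p ^ 2 * f t)) * h4

/-- A set of odd size is padded with one extra node of coefficient zero. -/
theorem IsOperatorMonotoneOn.sum_mul_nonneg {f : ℝ → ℝ}
    (hf : IsOperatorMonotoneOn.{u} f (Set.Ioi 0)) (hpos : ∀ t, 0 < t → 0 < f t) {S : Finset ℝ}
    (hS0 : ∀ t ∈ S, 0 < t) {c : ℝ → ℝ}
    (hc : ∀ x, 0 < x → 0 ≤ ∑ t ∈ S, c t * (t / (t + x))) : 0 ≤ ∑ t ∈ S, c t * f t := by
  rcases Nat.even_or_odd' S.card with ⟨m, hm | hm⟩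
  · exact hf.sum_mul_nonneg_of_card hpos hS0 hm hc
  · obtain ⟨y, hy0, hyS⟩ : ∃ y, 0 < y ∧ y ∉ S := by
      obtain ⟨y, hy⟩ := (Set.Ioi_infinite (0 : ℝ)).exists_notMem_finset S
      exact ⟨y, hy.1, hy.2⟩
    have hne : ∀ t ∈ S, t ≠ y := fun t ht h => hyS (h ▸ ht)
    have hsum : ∀ g : ℝ → ℝ, ∑ t ∈ insert y S, (if t = y then 0 else c t) * g t
        = ∑ t ∈ S, c t * g t := by
      intro g
      rw [Finset.sum_insert hyS, if_pos rfl, zero_mul, zero_add]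
      exact Finset.sum_congr rfl fun t ht => by rw [if_neg (hne t ht)]
    rw [← hsum]
    refine hf.sum_mul_nonneg_of_card hpos (m := m + 1) ?_ ?_ fun x hx => ?_
    · intro t ht
      rcases Finset.mem_insert.mp ht with rfl | ht
      exacts [hy0, hS0 t ht]
    · rw [Finset.card_insert_of_notMem hyS, hm]; ring
    · rw [hsum fun t => t / (t + x)]
      exact hc x hx

/-- The convex cone spanned by the functions `t ↦ t / (t + x)` with `x > 0`. -/
def rationalCone : Submodule ℝ≥0 (ℝ → ℝ) :=
  Submodule.span ℝ≥0 {k | ∃ x : ℝ, 0 < x ∧ k = fun t => t / (t + x)}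

/-- A positive operator monotone function on the half-line is a pointwise limit of functions in
`rationalCone`. -/
theorem IsOperatorMonotoneOn.exists_mem_rationalCone {f : ℝ → ℝ}
    (hf : IsOperatorMonotoneOn.{u} f (Set.Ioi 0)) (hpos : ∀ t, 0 < t → 0 < f t) {S : Finset ℝ}
    (hS0 : ∀ t ∈ S, 0 < t) {ε : ℝ} (hε : 0 < ε) :
    ∃ φ ∈ rationalCone, ∀ t ∈ S, |φ t - f t| < ε := by
  set R : (ℝ → ℝ) →ₗ[ℝ≥0] (S → ℝ) :=
    { toFun := fun g t => g t, map_add' := fun _ _ => rfl, map_smul' := fun _ _ => rfl } with hR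
  have hconv : Convex ℝ (R '' rationalCone) := by
    rintro _ ⟨g, hg, rfl⟩ _ ⟨h, hh, rfl⟩ a b ha hb _
    refine ⟨(⟨a, ha⟩ : ℝ≥0) • g + (⟨b, hb⟩ : ℝ≥0) • h,
      add_mem (Submodule.smul_mem _ _ hg) (Submodule.smul_mem _ _ hh), ?_⟩
    rw [map_add, map_smul, map_smul]
    rfl
  have hmem : R f ∈ closure (R '' rationalCone) := by
    by_contra hnot
    obtain ⟨Λ, u, hu, hΛ⟩ := geometric_hahn_banach_point_closed hconv.closure isClosed_closure hnot
    have hu0 : u < 0 := by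
      simpa using hΛ 0 (subset_closure ⟨0, zero_mem _, map_zero R⟩)
    set c : ℝ → ℝ := fun t => if h : t ∈ S then Λ (Pi.single ⟨t, h⟩ 1) else 0 with hc
    have hΛc : ∀ g : ℝ → ℝ, Λ (R g) = ∑ t ∈ S, c t * g t := by
      intro g
      have h1 : R g = ∑ t : S, g t • (Pi.single t 1 : S → ℝ) := by
        ext t
        simp [hR, Finset.sum_apply, Pi.single_apply]
      rw [h1, map_sum, ← Finset.sum_coe_sort S]
      refine Finset.sum_congr rfl fun t _ => ?_
      rw [map_smul, smul_eq_mul, mul_comm, hc]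
      simp
    have hcnn : ∀ x, 0 < x → 0 ≤ ∑ t ∈ S, c t * (t / (t + x)) := by
      intro x hx
      rw [← hΛc fun t => t / (t + x)]
      by_contra! hneg
      -- A negative value on a generator would, after scaling by a large `n`, fall below the
      -- separating bound `u`.
      obtain ⟨n, hn⟩ := exists_nat_gt (u / Λ (R fun t => t / (t + x)))
      rw [div_lt_iff_of_neg hneg] at hn
      have h2 := hΛ (R ((n : ℝ≥0) • fun t => t / (t + x)))
        (subset_closure ⟨_, Submodule.smul_mem _ _ (Submodule.subset_span ⟨x, hx, rfl⟩), rfl⟩)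
      have h3 : R ((n : ℝ≥0) • fun t => t / (t + x)) = (n : ℝ) • R fun t => t / (t + x) := by
        rw [map_smul]
        ext t
        simp [NNReal.smul_def]
      rw [h3, map_smul, smul_eq_mul] at h2
      linarith
    have := hf.sum_mul_nonneg hpos hS0 hcnn
    rw [← hΛc] at this
    linarith
  obtain ⟨_, ⟨φ, hφ, rfl⟩, hdist⟩ := Metric.mem_closure_iff.mp hmem ε hε
  refine ⟨φ, hφ, fun t ht => ?_⟩
  have h1 := (dist_pi_lt_iff hε).mp hdist ⟨t, ht⟩
  rw [dist_comm, Real.dist_eq] at h1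
  exact h1

/-! ### Operator decreasing divided differences and passage to the limit -/

theorem isOperatorMonotoneOn_neg_div_add {x c : ℝ} (hx : 0 < x) (hc : 0 ≤ c) :
    IsOperatorMonotoneOn.{u} (fun t => -(c * (t + x)⁻¹)) (Set.Ioi 0) := by
  intro 𝒜 _ _ _ A B hA hB hAI hBI _ _ hAB
  have hcfc : ∀ M : 𝒜, IsSelfAdjoint M → spectrum ℝ M ⊆ Set.Ioi 0 →
      IsStrictlyPositive (M + algebraMap ℝ 𝒜 x) ∧
      cfc (fun t => -(c * (t + x)⁻¹)) M = -(c • Ring.inverse (M + algebraMap ℝ 𝒜 x)) := by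
    intro M hM hMI
    have h0 : ∀ t ∈ spectrum ℝ M, 0 < t + x := fun t ht => add_pos (hMI ht) hx
    have h1 : cfc (fun t : ℝ => t + x) M = M + algebraMap ℝ 𝒜 x := by
      rw [cfc_add_const x (fun t => t) M, cfc_id' ℝ M]
    have h2 : cfc (fun t : ℝ => (t + x)⁻¹) M = Ring.inverse (M + algebraMap ℝ 𝒜 x) := by
      rw [cfc_inv (fun t : ℝ => t + x) M (fun t ht => (h0 t ht).ne'), h1]
    have h3 : ContinuousOn (fun t : ℝ => (t + x)⁻¹) (spectrum ℝ M) :=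
      (continuousOn_id.add continuousOn_const).inv₀ fun t ht => (h0 t ht).ne'
    refine ⟨?_, ?_⟩
    · rw [← h1, cfc_isStrictlyPositive_iff (fun t : ℝ => t + x) M]
      exact h0
    · rw [cfc_neg, cfc_const_mul c _ M h3, h2]
  rw [(hcfc A hA hAI).2, (hcfc B hB hBI).2, neg_le_neg_iff]
  refine smul_le_smul_of_nonneg_left ?_ hc
  exact CStarAlgebra.ringInverse_le_ringInverse (add_le_add_left hAB _) (hcfc A hA hAI).1

theorem continuousOn_Ioi_of_abs_sub_le {ψ : ℝ → ℝ} {C : ℝ}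
    (h : ∀ s t, 0 < s → 0 < t → |ψ s - ψ t| ≤ |s - t| * (C / t)) :
    ContinuousOn ψ (Set.Ioi 0) := by
  intro t ht
  rw [ContinuousWithinAt, tendsto_iff_dist_tendsto_zero]
  have hlim : Tendsto (fun s => |s - t| * (C / t)) (𝓝[Set.Ioi 0] t) (𝓝 0) := by
    have : Continuous fun s => |s - t| * (C / t) := by fun_prop
    simpa using (this.tendsto t).mono_left nhdsWithin_le_nhds
  refine squeeze_zero' (Eventually.of_forall fun _ => dist_nonneg) ?_ hlim
  filter_upwards [self_mem_nhdsWithin] with s hs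
  rw [Real.dist_eq]
  exact h s t hs ht

/-- The common modulus of continuity upgrades pointwise convergence to locally uniform convergence.
-/
theorem tendstoUniformlyOn_of_abs_sub_le {J : Type*} {l : Filter J} {ψ : J → ℝ → ℝ} {ψ₀ : ℝ → ℝ}
    {C : ℝ} (h : ∀ i s t, 0 < s → 0 < t → |ψ i s - ψ i t| ≤ |s - t| * (C / t))
    (h₀ : ∀ s t, 0 < s → 0 < t → |ψ₀ s - ψ₀ t| ≤ |s - t| * (C / t))
    (hlim : ∀ t, 0 < t → Tendsto (fun i => ψ i t) l (𝓝 (ψ₀ t))) {K : Set ℝ} (hK : IsCompact K)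
    (hK0 : K ⊆ Set.Ioi 0) : TendstoUniformlyOn ψ ψ₀ l K := by
  rw [← tendstoLocallyUniformlyOn_iff_tendstoUniformlyOn_of_compact hK,
    Metric.tendstoLocallyUniformlyOn_iff]
  intro ε hε t ht
  have ht0 : 0 < t := hK0 ht
  have hs : ∀ᶠ s in 𝓝[K] t, |s - t| * (C / t) < ε / 3 := by
    have : Continuous fun s => |s - t| * (C / t) := by fun_prop
    have h1 := (this.tendsto t).mono_left (nhdsWithin_le_nhds (s := K))
    simp only [sub_self, abs_zero, zero_mul] at h1
    exact h1.eventually_lt_const (by positivity)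
  refine ⟨_, hs.and self_mem_nhdsWithin, ?_⟩
  filter_upwards [Metric.tendsto_nhds.mp (hlim t ht0) (ε / 3) (by positivity)] with i hi
  rintro s ⟨hs1, hs2⟩
  have e1 := h i s t (hK0 hs2) ht0
  have e2 := h₀ s t (hK0 hs2) ht0
  rw [Real.dist_eq] at hi ⊢
  calc |ψ₀ s - ψ i s| = |(ψ₀ s - ψ₀ t) - (ψ i t - ψ₀ t) - (ψ i s - ψ i t)| := by ring_nf
    _ ≤ |ψ₀ s - ψ₀ t| + |ψ i t - ψ₀ t| + |ψ i s - ψ i t| :=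
        (abs_sub _ _).trans (add_le_add_left (abs_sub _ _) _)
    _ < ε := by linarith

/-- Functions in `rationalCone` have operator decreasing divided differences, which satisfy a
Lipschitz bound depending only on the value at the base point. -/
theorem exists_dividedDifference_of_mem_rationalCone {φ : ℝ → ℝ} (hφ : φ ∈ rationalCone) {t₁ : ℝ}
    (ht₁ : 0 < t₁) :
    ∃ ψ : ℝ → ℝ, (∀ t, 0 < t → φ t - φ t₁ = (t - t₁) * ψ t) ∧
      (∀ s t, 0 < s → 0 < t → |ψ s - ψ t| ≤ |s - t| * (φ t₁ / t₁ / t)) ∧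
      IsOperatorMonotoneOn.{u} (fun t => -ψ t) (Set.Ioi 0) := by
  have hcont : ∀ {𝒜 : Type u} [CStarAlgebra 𝒜] {M : 𝒜} {ψ : ℝ → ℝ} {C : ℝ},
      (∀ s t, 0 < s → 0 < t → |ψ s - ψ t| ≤ |s - t| * (C / t)) → spectrum ℝ M ⊆ Set.Ioi 0 →
      ContinuousOn (fun t => -ψ t) (spectrum ℝ M) := fun h hM =>
    ((continuousOn_Ioi_of_abs_sub_le h).mono hM).neg
  induction hφ using Submodule.span_induction with
  | mem φ h =>
    obtain ⟨x, hx, rfl⟩ := h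
    -- The Lipschitz bound uses `x / (s + x) ≤ 1` and `(t + x)⁻¹ ≤ t⁻¹`; the remaining factor `(t₁ +
    -- x)⁻¹` is `φ t₁ / t₁`. The bound is linear in `φ`, so it survives sums and scaling.
    refine ⟨fun t => x / (t₁ + x) * (t + x)⁻¹, fun t ht => ?_, fun s t hs ht => ?_,
      isOperatorMonotoneOn_neg_div_add hx (by positivity)⟩
    · field_simp
      ring
    · have h1 : x / (t₁ + x) * (s + x)⁻¹ - x / (t₁ + x) * (t + x)⁻¹
          = (t - s) * (x / (s + x) * (t₁ + x)⁻¹ * (t + x)⁻¹) := by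
        field_simp
        ring
      have h2 : t₁ / (t₁ + x) / t₁ / t = 1 * (t₁ + x)⁻¹ * t⁻¹ := by
        field_simp
      rw [h1, abs_mul, abs_sub_comm, abs_of_nonneg (a := x / (s + x) * _ * _) (by positivity), h2]
      have h3 : x / (s + x) ≤ 1 := (div_le_one (by positivity)).mpr (by linarith)
      have h4 : (t + x)⁻¹ ≤ t⁻¹ := inv_anti₀ ht (by linarith)
      gcongr
  | zero =>
    refine ⟨0, by simp, by simp, ?_⟩
    intro 𝒜 _ _ _ A B hA hB _ _ _ _ _
    simp
  | add φ φ' _ _ ih ih' =>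
    obtain ⟨ψ, h1, h2, h3⟩ := ih
    obtain ⟨ψ', h1', h2', h3'⟩ := ih'
    refine ⟨fun t => ψ t + ψ' t, fun t ht => ?_, fun s t hs ht => ?_, ?_⟩
    · have := h1 t ht; have := h1' t ht
      simp only [Pi.add_apply]
      linarith
    · have e1 := h2 s t hs ht; have e2 := h2' s t hs ht
      calc |ψ s + ψ' s - (ψ t + ψ' t)| = |(ψ s - ψ t) + (ψ' s - ψ' t)| := by ring_nf
        _ ≤ _ := abs_add_le _ _
        _ ≤ _ := add_le_add e1 e2
        _ = _ := by simp only [Pi.add_apply]; ring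
    · intro 𝒜 _ _ _ A B hA hB hAI hBI _ _ hAB
      simp only [neg_add]
      rw [cfc_add _ _ _ (hcont h2 hAI) (hcont h2' hAI),
        cfc_add _ _ _ (hcont h2 hBI) (hcont h2' hBI)]
      exact add_le_add (h3 𝒜 A B hA hB hAI hBI (hcont h2 hAI) (hcont h2 hBI) hAB)
        (h3' 𝒜 A B hA hB hAI hBI (hcont h2' hAI) (hcont h2' hBI) hAB)
  | smul a φ _ ih =>
    obtain ⟨ψ, h1, h2, h3⟩ := ih
    refine ⟨fun t => a * ψ t, fun t ht => ?_, fun s t hs ht => ?_, ?_⟩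
    · simp only [Pi.smul_apply, NNReal.smul_def, smul_eq_mul]
      linear_combination (a : ℝ) * h1 t ht
    · rw [← mul_sub, abs_mul, abs_of_nonneg a.coe_nonneg]
      refine (mul_le_mul_of_nonneg_left (h2 s t hs ht) a.coe_nonneg).trans_eq ?_
      simp only [Pi.smul_apply, NNReal.smul_def, smul_eq_mul]
      ring
    · intro 𝒜 _ _ _ A B hA hB hAI hBI _ _ hAB
      simp only [← mul_neg]
      rw [cfc_const_mul _ _ _ (hcont h2 hAI), cfc_const_mul _ _ _ (hcont h2 hBI)]
      exact smul_le_smul_of_nonneg_left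
        (h3 𝒜 A B hA hB hAI hBI (hcont h2 hAI) (hcont h2 hBI) hAB) a.coe_nonneg

/-- A positive operator monotone function on the half-line has a continuous, operator decreasing
divided difference at each point. -/
theorem IsOperatorMonotoneOn.exists_dividedDifference {f : ℝ → ℝ}
    (hf : IsOperatorMonotoneOn.{u} f (Set.Ioi 0)) (hpos : ∀ t, 0 < t → 0 < f t) {t₁ : ℝ}
    (ht₁ : 0 < t₁) :
    ∃ ψ : ℝ → ℝ, (∀ t, 0 < t → f t - f t₁ = (t - t₁) * ψ t) ∧ ContinuousOn ψ (Set.Ioi 0) ∧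
      IsOperatorMonotoneOn.{u} (fun t => -ψ t) (Set.Ioi 0) := by
  classical
  let J := Finset (Set.Ioi (0 : ℝ)) × ℕ
  have hφ : ∀ i : J, ∃ φ ∈ rationalCone, ∀ t ∈ insert t₁ (i.1.image Subtype.val),
      |φ t - f t| < 1 / ((i.2 : ℝ) + 1) := fun i => by
    refine hf.exists_mem_rationalCone hpos (fun t ht => ?_) (by positivity)
    rcases Finset.mem_insert.mp ht with rfl | ht
    · exact ht₁
    · obtain ⟨s, _, rfl⟩ := Finset.mem_image.mp ht
      exact s.2
  choose φ hφK hφf using hφ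
  choose ψ hψ hψL hψm using fun i =>
    exists_dividedDifference_of_mem_rationalCone.{u} (hφK i) ht₁
  -- Every approximation set contains `t₁` and every error is below `1`, so this bound serves all
  -- indices.
  set M := (f t₁ + 1) / t₁ with hM
  have hψM : ∀ i s t, 0 < s → 0 < t → |ψ i s - ψ i t| ≤ |s - t| * (M / t) := by
    intro i s t hs ht
    refine (hψL i s t hs ht).trans (mul_le_mul_of_nonneg_left ?_ (abs_nonneg _))
    have h1 := (abs_lt.mp (hφf i t₁ (Finset.mem_insert_self _ _))).2
    have h2 : 1 / ((i.2 : ℝ) + 1) ≤ 1 :=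
      (div_le_one (by positivity)).mpr (le_add_of_nonneg_left (Nat.cast_nonneg _))
    rw [hM]
    gcongr
    linarith
  -- Convergence of `φ i` does not directly control `ψ i t₁`. These values are eventually bounded
  -- along `U`, so the ultrafilter supplies a limit by compactness.
  let U : Ultrafilter J := Ultrafilter.of atTop
  have hφlim : ∀ t, 0 < t → Tendsto (fun i => φ i t) U (𝓝 (f t)) := by
    intro t ht
    refine Tendsto.mono_left ?_ (Ultrafilter.of_le atTop)
    rw [tendsto_iff_dist_tendsto_zero]
    have h1 : Tendsto (fun i : J => 1 / ((i.2 : ℝ) + 1)) atTop (𝓝 0) := by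
      rw [← prod_atTop_atTop_eq]
      exact tendsto_one_div_add_atTop_nhds_zero_nat.comp tendsto_snd
    refine squeeze_zero' (Eventually.of_forall fun _ => dist_nonneg) ?_ h1
    filter_upwards [eventually_ge_atTop (({⟨t, ht⟩}, 0) : J)] with i hi
    rw [Real.dist_eq]
    refine (hφf i t (Finset.mem_insert_of_mem (Finset.mem_image.mpr ⟨⟨t, ht⟩, ?_, rfl⟩))).le
    exact hi.1 (Finset.mem_singleton_self _)
  have hψlim : ∀ t, 0 < t → t ≠ t₁ →
      Tendsto (fun i => ψ i t) U (𝓝 ((f t - f t₁) / (t - t₁))) := by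
    intro t ht hne
    have h1 := ((hφlim t ht).sub (hφlim t₁ ht₁)).div_const (t - t₁)
    refine h1.congr fun i => ?_
    rw [hψ i t ht, mul_div_cancel_left₀ _ (sub_ne_zero.mpr hne)]
  obtain ⟨d, hd⟩ : ∃ d, Tendsto (fun i => ψ i t₁) U (𝓝 d) := by
    -- `2 * t₁` is just a point other than `t₁`, where `ψ i` is known to converge; the Lipschitz
    -- bound carries boundedness over to `t₁`.
    have h2 : 0 < 2 * t₁ := by positivity
    have h3 := hψlim (2 * t₁) h2 (by linarith)
    set y := (f (2 * t₁) - f t₁) / (2 * t₁ - t₁)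
    have h4 : ∀ᶠ i in (U : Filter J),
        ψ i t₁ ∈ Metric.closedBall y (|t₁ - 2 * t₁| * (M / (2 * t₁)) + 1) := by
      filter_upwards [Metric.tendsto_nhds.mp h3 1 one_pos] with i hi
      rw [Metric.mem_closedBall]
      refine (dist_triangle _ (ψ i (2 * t₁)) _).trans (add_le_add ?_ hi.le)
      rw [Real.dist_eq]
      exact hψM i _ _ ht₁ h2
    obtain ⟨d, _, hd⟩ := (isCompact_closedBall _ _).ultrafilter_le_nhds'
      (U.map fun i => ψ i t₁) h4
    exact ⟨d, hd⟩
  set ψ₀ : ℝ → ℝ := fun t => if t = t₁ then d else (f t - f t₁) / (t - t₁) with hψ₀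
  have hlim : ∀ t, 0 < t → Tendsto (fun i => ψ i t) U (𝓝 (ψ₀ t)) := by
    intro t ht
    by_cases h : t = t₁
    · simpa [hψ₀, h] using hd
    · simpa [hψ₀, h] using hψlim t ht h
  have hψ₀M : ∀ s t, 0 < s → 0 < t → |ψ₀ s - ψ₀ t| ≤ |s - t| * (M / t) := fun s t hs ht =>
    le_of_tendsto ((hlim s hs).sub (hlim t ht)).abs
      (Eventually.of_forall fun i => hψM i s t hs ht)
  refine ⟨ψ₀, fun t _ => ?_, continuousOn_Ioi_of_abs_sub_le hψ₀M, ?_⟩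
  · by_cases h : t = t₁
    · simp [h]
    · simp only [hψ₀, if_neg h]
      rw [mul_div_cancel₀ _ (sub_ne_zero.mpr h)]
  · intro 𝒜 _ _ _ A B hA hB hAI hBI _ _ hAB
    have hcfc : ∀ N : 𝒜, spectrum ℝ N ⊆ Set.Ioi 0 →
        Tendsto (fun i => cfc (fun t => -ψ i t) N) U (𝓝 (cfc (fun t => -ψ₀ t) N)) := by
      intro N hN
      refine tendsto_cfc_fun ?_ (Eventually.of_forall fun i => ?_)
      · exact (tendstoUniformlyOn_of_abs_sub_le hψM hψ₀M hlim (spectrum.isCompact N) hN).neg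
      · exact ((continuousOn_Ioi_of_abs_sub_le (hψM i)).mono hN).neg
    refine le_of_tendsto_of_tendsto' (hcfc A hAI) (hcfc B hBI) fun i => ?_
    exact hψm i 𝒜 A B hA hB hAI hBI ((continuousOn_Ioi_of_abs_sub_le (hψM i)).mono hAI).neg
      ((continuousOn_Ioi_of_abs_sub_le (hψM i)).mono hBI).neg hAB

theorem mainTheorem4 (f : ℝ → ℝ) (hpos : ∀ t : ℝ, 0 < t → 0 < f t)
    (hf : IsOperatorMonotoneOn.{u} f (Set.Ioi 0)) :
    DifferentiableOn ℝ f (Set.Ioi 0) ∧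
      ∀ t₁ : ℝ, 0 < t₁ →
        IsOperatorMonotoneOn.{u} (fun t => -dividedDifference t₁ f t) (Set.Ioi 0) := by
  have key : ∀ t₁ : ℝ, 0 < t₁ → ∃ ψ : ℝ → ℝ, HasDerivAt f (ψ t₁) t₁ ∧
      (∀ t, 0 < t → ψ t = dividedDifference t₁ f t) ∧
      IsOperatorMonotoneOn.{u} (fun t => -ψ t) (Set.Ioi 0) := by
    intro t₁ ht₁
    obtain ⟨ψ, h1, h2, h3⟩ := hf.exists_dividedDifference hpos ht₁
    have hslope : ∀ t, 0 < t → t ≠ t₁ → ψ t = (f t - f t₁) / (t - t₁) := fun t ht hne => by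
      rw [h1 t ht, mul_div_cancel_left₀ _ (sub_ne_zero.mpr hne)]
    -- Away from `t₁` the function `ψ` is the slope of `f`, so its continuity at `t₁` is the
    -- differentiability of `f` there.
    have hderiv : HasDerivAt f (ψ t₁) t₁ := by
      rw [hasDerivAt_iff_tendsto_slope]
      have h4 : Tendsto ψ (𝓝[≠] t₁) (𝓝 (ψ t₁)) :=
        ((h2.continuousAt (Ioi_mem_nhds ht₁)).tendsto).mono_left nhdsWithin_le_nhds
      refine h4.congr' ?_
      filter_upwards [self_mem_nhdsWithin, nhdsWithin_le_nhds (Ioi_mem_nhds ht₁)] with t hne ht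
      rw [hslope t ht hne, slope_def_field]
    refine ⟨ψ, hderiv, fun t ht => ?_, h3⟩
    by_cases h : t = t₁
    · rw [dividedDifference, if_pos h, h, hderiv.deriv]
    · rw [dividedDifference, if_neg h, hslope t ht h]
  refine ⟨fun t₁ ht₁ => ?_, fun t₁ ht₁ => ?_⟩
  · obtain ⟨_, h, _⟩ := key t₁ ht₁
    exact h.differentiableAt.differentiableWithinAt
  · obtain ⟨ψ, _, h, hm⟩ := key t₁ ht₁
    intro 𝒜 _ _ _ A B hA hB hAI hBI hcA hcB hAB
    have hEq : ∀ M : 𝒜, spectrum ℝ M ⊆ Set.Ioi 0 →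
        Set.EqOn (fun t => -dividedDifference t₁ f t) (fun t => -ψ t) (spectrum ℝ M) :=
      fun M hM t ht => congrArg Neg.neg (h t (hM ht)).symm
    rw [cfc_congr (hEq A hAI), cfc_congr (hEq B hBI)]
    exact hm 𝒜 A B hA hB hAI hBI (hcA.congr (hEq A hAI).symm) (hcB.congr (hEq B hBI).symm) hAB
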